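/- **Setting.** Let $1\le K\le N$ and $1\le\rho\le P$ be integers and $0\le M_U\le N$, and suppose that $t=KM_U/N$ is an integer. A library of $N$ independent files, each uniform on $\{0,1\}^F$, is stored in $P$ servers with storage of $M_SF$ bits, $M_S=N/\rho$, and is requested by $K$ users with caches of $M_UF$ bits. A topology $\mathcal Z$ connects every user $k$ to a set $\mathcal Z_k$ of exactly $\rho$ servers; $\mathcal K_p$ is the set of users served by server $p$, and $q_p=|\mathcal K_p|$. *Placement* (without knowledge of demands and topology). Caches are uncoded: each bit of each file is cached by some set of users, and the segment $W_{n,\mathcal A}$ is the part of file $n$ cached exactly by the users in $\mathcal A\subseteq[K]$. Storage is $(P,\rho)$ MDS coded: each segment $W_{n,\mathcal A}$ is separately encoded into coded subsegments $C^1_{n,\mathcal A},\dots,C^P_{n,\mathcal A}$ of $|W_{n,\mathcal A}|/\rho$ bits each, any $\rho$ of which determine the segment; server $p$ stores all $C^p_{n,\mathcal A}$. Call the placement *symmetric* if $\sum_n|W_{n,\mathcal A}|$ depends only on $|\mathcal A|$ (in particular this holds if $|W_{n,\mathcal A}|$ depends only on $|\mathcal A|$). *Delivery.* Given the topology, server $p$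 sends a message of at most $R_pF$ bits that is a function of the demand vector $\mathbf d\in[N]^K$ and of the contents of server $p$; user $k$ estimates $W_{d_k}$ from $\mathbf d$, the messages of the servers in $\mathcal Z_k$ and its cache. Rates $R_p=R_p(\mathcal Z)$ are achievable for a set of topologies, within a class of placements, if for every $\varepsilon>0$ there are arbitrarily large $F$ and one placement of the class which, for every topology in the set, allows a delivery with these rates whose error probability is less than $\varepsilon$ for all demands and users. With successive transmissions the latency is $T_{sd}(\mathcal Z)=\sum_pR_p(\mathcal Z)$. Put $$R_p^*(\mathcal Z)=\frac{\binom K{t+1}-\binom{K-q_p}{t+1}}{\rho\binom Kt},\qquad T^*(\mathcal Z)=\sum_{p=1}^PR_p^*(\mathcal Z).$$ **Theorem.** 1. For every topology $\mathcal Z$, rates that are achievable for $\mathcal Z$ with symmetric placements satisfy $T_{sd}(\mathcal Z)\ge T^*(\mathcal Z)$. 2. For arbitrary placements of the above kind (uncoded caches, MDS-coded storage): for every topology $\mathcal Z$, if rates are achievable for all topologies obtained from $\mathcal Z$ by permuting the users, then the average of $T_{sd}$ over the $K!$ permutations of the users is at least $T^*(\mathcal Z)$. 3. For arbitrary placements of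 the above kind, if rates are achievable for all topologies, then $\mathbb E[T_{sd}(\mathcal Z)]\ge\mathbb E[T^*(\mathcal Z)]$, where $\mathcal Z$ is uniform over all topologies. 4. The bounds are attained by the following scheme. Let $F=\binom Kt\rho s$. Split every file into $\binom Kt$ equal segments, indexed by the $t$-subsets $\mathcal A$ of $[K]$, and cache the segment of $\mathcal A$ at the users in $\mathcal A$. Split each segment into $\rho$ subsegments of $s$ bits and encode these by a linear $(P,\rho)$ MDS code on blocks of $s$ bits; server $p$ stores the $p$-th coded subsegments. For every $(t+1)$-subset $\mathcal H$ of $[K]$ with $\mathcal H\cap\mathcal K_p\ne\emptyset$, server $p$ sends $\bigoplus_{k\in\mathcal H\cap\mathcal K_p}C^p_{d_k,\mathcal H\setminus\{k\}}$. This placement is symmetric and obeys the memory constraints, and for every topology and all demands all users decode without error from messages of exactly $FR_p^*(\mathcal Z)$ bits, $p\in[P]$. The required MDS codes exist whenever $2^s\ge P$. Hence the rates $R^*_p(\mathcal Z)$ are achievable for all topologies at once with symmetric placements, and the scheme is optimal in the sense of 1, 2 and 3. -/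

import Mathlib

namespace CodedCaching

/-- A library of `N` files of `F` bits each.  Independent files, uniform over `F` bits, mean that
the library is uniformly distributed over this finite type. -/
abbrev Library (N F : ℕ) : Type := Fin N → Fin F → ZMod 2

/-- A network topology: every one of the `K` users is connected to exactly `ρ` of the `P` servers. -/
abbrev Topology (K P ρ : ℕ) : Type := Fin K → {Z : Finset (Fin P) // Z.card = ρ}

/-- The set of users that server `p` serves. -/
def Topology.served {K P ρ : ℕ} (Z : Topology K P ρ) (p : Fin P) : Finset (Fin K) :=
  Finset.univ.filter fun k => p ∈ (Z k).1

/-- The topology obtained by permuting the users. -/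
def Topology.relabel {K P ρ : ℕ} (Z : Topology K P ρ) (τ : Equiv.Perm (Fin K)) : Topology K P ρ :=
  fun k => Z (τ k)

/-- The data of a placement phase with uncoded user caches and segment-wise coded server storage.
Bit `b` of file `n` is cached exactly by the users in `cachedBy n b`; so the segment `W_{n,A}`
consists of the bits `b` of file `n` with `cachedBy n b = A`, and every uncoded placement is of
this form.  Every segment `W_{n,A}` is encoded separately into one coded subsegment for each
server `p`; the bits of this coded subsegment are indexed by the finite type `Sub n A`.
The placement knows neither the demands nor the topology. -/
structure Placement (K P N F : ℕ) where
  cachedBy : Fin N → Fin F → Finset (Fin K)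
  Sub : Fin N → Finset (Fin K) → Type
  [fintypeSub : ∀ n A, Fintype (Sub n A)]
  code : (p : Fin P) → (n : Fin N) → (A : Finset (Fin K)) →
    ({b : Fin F // cachedBy n b = A} → ZMod 2) → (Sub n A → ZMod 2)

attribute [instance] Placement.fintypeSub

namespace Placement

variable {K P N F : ℕ} (C : Placement K P N F)

/-- The positions (file, bit) that user `k` caches. -/
abbrev CachePos (k : Fin K) : Type := {i : Fin N × Fin F // k ∈ C.cachedBy i.1 i.2}

/-- The cache contents `V_k` of user `k`. -/
def cache (k : Fin K) (W : Library N F) : C.CachePos k → ZMod 2 :=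
  fun i => W i.1.1 i.1.2

/-- The segment `W_{n,A}`: the part of file `n` cached exclusively by the users in `A`. -/
def segment (W : Library N F) (n : Fin N) (A : Finset (Fin K)) :
    {b : Fin F // C.cachedBy n b = A} → ZMod 2 :=
  fun b => W n b.1

/-- The size `|W_{n,A}|` in bits. -/
def segSize (n : Fin N) (A : Finset (Fin K)) : ℕ :=
  Fintype.card {b : Fin F // C.cachedBy n b = A}

/-- The possible storage contents of a server: one coded subsegment for every segment. -/
abbrev Content : Type := (n : Fin N) → (A : Finset (Fin K)) → C.Sub n A → ZMod 2

/-- The storage contents `Y_p` of server `p`. -/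
def storage (p : Fin P) (W : Library N F) : C.Content :=
  fun n A => C.code p n A (C.segment W n A)

/-- The number of bits stored by a server. -/
def storageSize : ℕ := ∑ n : Fin N, ∑ A : Finset (Fin K), Fintype.card (C.Sub n A)

/-- The number of bits cached by user `k`. -/
def cacheSize (k : Fin K) : ℕ := Fintype.card (C.CachePos k)

/-- Every segment is encoded by a `(P, ρ)` MDS code: a coded subsegment has the `ρ`-th part of the
size of the segment, and any `ρ` coded subsegments determine the segment. -/
def IsMDS (ρ : ℕ) : Prop :=
  ∀ (n : Fin N) (A : Finset (Fin K)),
    ρ * Fintype.card (C.Sub n A) = C.segSize n A ∧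
    ∀ S : Finset (Fin P), S.card = ρ →
      Function.Injective
        (fun (w : {b : Fin F // C.cachedBy n b = A} → ZMod 2) (p : S) => C.code p.1 n A w)

/-- `(P, ρ)` MDS-coded storage in servers of `F * MS` bits, uncoded caches of `F * MU` bits. -/
def Admissible (ρ : ℕ) (MS MU : ℝ) : Prop :=
  C.IsMDS ρ ∧ (C.storageSize : ℝ) ≤ F * MS ∧ ∀ k, (C.cacheSize k : ℝ) ≤ F * MU

/-- The total size over all files of the segments cached exactly by `A` depends on `|A|` only. -/
def Symmetric : Prop :=
  ∀ A B : Finset (Fin K), A.card = B.card → ∑ n, C.segSize n A = ∑ n, C.segSize n B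

end Placement

/-- The encoding functions of the delivery phase: given the demands, server `p` maps its own storage
contents to a message whose bits are indexed by the finite type `Bits p`.  (An encoding is chosen
for a given topology.) -/
structure Encoding {K P N F : ℕ} (C : Placement K P N F) where
  Bits : Fin P → Type
  [fintypeBits : ∀ p, Fintype (Bits p)]
  enc : (p : Fin P) → (Fin K → Fin N) → C.Content → (Bits p → ZMod 2)

attribute [instance] Encoding.fintypeBits

namespace Encoding

variable {K P N F : ℕ} {C : Placement K P N F} (E : Encoding C)

/-- The message `X_p` of server `p` for the demand vector `d`. -/
def message (p : Fin P) (d : Fin K → Fin N) (W : Library N F) : E.Bits p → ZMod 2 :=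
  E.enc p d (C.storage p W)

/-- The decoding functions for the topology `Z`: user `k` maps the demands, the messages of the
servers it is connected to and its cache contents to an estimate of its requested file. -/
abbrev Decoding {ρ : ℕ} (Z : Topology K P ρ) : Type :=
  (k : Fin K) → (Fin K → Fin N) → ((p : (Z k).1) → E.Bits p.1 → ZMod 2) →
    (C.CachePos k → ZMod 2) → (Fin F → ZMod 2)

/-- The file that user `k` reconstructs. -/
def estimate {ρ : ℕ} {Z : Topology K P ρ} (D : E.Decoding Z) (k : Fin K) (d : Fin K → Fin N)
    (W : Library N F) : Fin F → ZMod 2 :=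
  D k d (fun p => E.message p.1 d W) (C.cache k W)

/-- The probability, for a uniform library, that user `k` does not reconstruct its file. -/
noncomputable def errorProb {ρ : ℕ} {Z : Topology K P ρ} (D : E.Decoding Z) (k : Fin K)
    (d : Fin K → Fin N) : ℝ :=
  ((Finset.univ.filter fun W : Library N F => E.estimate D k d W ≠ W (d k)).card : ℝ) /
    (Fintype.card (Library N F) : ℝ)

end Encoding

/-- The rates `R Z p` (the size of the message of server `p` in topology `Z`, divided by the file
size) are achievable for the topologies in `T` by placements in the class `Cl`: for every `ε > 0`
and arbitrarily large file sizes `F` there is a placement in the class that obeys the memory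
constraints and, with this one placement, for every topology in `T` a delivery phase of these rates
whose error probability is less than `ε` for all demands and all users. -/
def Achievable {K P ρ : ℕ} (N : ℕ) (Cl : ∀ F : ℕ, Placement K P N F → Prop)
    (T : Set (Topology K P ρ)) (MS MU : ℝ) (R : Topology K P ρ → Fin P → ℝ) : Prop :=
  ∀ ε : ℝ, 0 < ε → ∀ F₀ : ℕ, ∃ F : ℕ, F₀ ≤ F ∧ ∃ C : Placement K P N F,
    Cl F C ∧ C.Admissible ρ MS MU ∧
    ∀ Z ∈ T, ∃ E : Encoding C,
      (∀ p, (Fintype.card (E.Bits p) : ℝ) ≤ F * R Z p) ∧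
      ∃ D : E.Decoding Z, ∀ d k, E.errorProb D k d < ε

/-- The delivery latency of successive transmissions, `T_sd = ∑ p, R_p`. -/
def latency {K P ρ : ℕ} (R : Topology K P ρ → Fin P → ℝ) (Z : Topology K P ρ) : ℝ :=
  ∑ p, R Z p

/-- The expectation over a uniformly random topology. -/
noncomputable def expect {K P ρ : ℕ} (f : Topology K P ρ → ℝ) : ℝ :=
  (∑ Z : Topology K P ρ, f Z) / (Fintype.card (Topology K P ρ) : ℝ)

/-- `(C(K,t+1) - C(K-q_p,t+1)) / (ρ C(K,t))`, where `q_p` is the number of users of server `p`. -/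
noncomputable def optRate {K P ρ : ℕ} (t : ℕ) (Z : Topology K P ρ) (p : Fin P) : ℝ :=
  ((K.choose (t + 1) : ℝ) - ((K - (Z.served p).card).choose (t + 1) : ℝ)) /
    ((ρ : ℝ) * (K.choose t : ℝ))

/-! ### The proposed scheme -/

/-- The `t`-element sets of users. -/
abbrev TSet (K t : ℕ) : Type := {A : Finset (Fin K) // A.card = t}

/-- `G` is the generator matrix of a linear `(P, ρ)` MDS code on blocks of `s` bits (for instance of
an MDS code over the field with `2 ^ s` elements): the `p`-th coded block is `∑ l, G p l * w l`, and
any `ρ` coded blocks determine the `ρ` blocks `w l`. -/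
def IsMDSGenerator {P ρ s : ℕ} (G : Fin P → Fin ρ → Matrix (Fin s) (Fin s) (ZMod 2)) : Prop :=
  ∀ S : Finset (Fin P), S.card = ρ →
    Function.Injective
      (fun (w : Fin ρ → Fin s → ZMod 2) (p : S) => ∑ l, (G p.1 l).mulVec (w l))

/-- The placement of the proposed scheme.  Through `e`, the `F` bits of a file are split into equal
segments indexed by the `t`-sets `A` of users, and every segment into `ρ` subsegments of `s` bits.
The segment of `A` is cached by the users in `A`; server `p` stores the `p`-th coded subsegment
(`s` bits if `|A| = t`, and nothing for the other, empty, segments). -/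
def proposedPlacement {K P ρ s t F : ℕ} (N : ℕ) (e : Fin F ≃ TSet K t × Fin ρ × Fin s)
    (G : Fin P → Fin ρ → Matrix (Fin s) (Fin s) (ZMod 2)) : Placement K P N F where
  cachedBy _ b := (e b).1.1
  Sub _ A := {_i : Fin s // A.card = t}
  code p _ A w i :=
    ∑ l, (G p l).mulVec (fun j => w ⟨e.symm (⟨A, i.2⟩, l, j), by simp⟩) i.1

/-- The delivery of the proposed scheme: for every `(t+1)`-set `H` of users that contains a user of
server `p`, this server sends the XOR of the coded subsegments `C^p_{d_k, H \ {k}}` over the users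
`k` of `H` that it serves. -/
def proposedEncoding {K P ρ s t F N : ℕ} (e : Fin F ≃ TSet K t × Fin ρ × Fin s)
    (G : Fin P → Fin ρ → Matrix (Fin s) (Fin s) (ZMod 2)) (Z : Topology K P ρ) :
    Encoding (proposedPlacement N e G) where
  Bits p := {H : Finset (Fin K) // H.card = t + 1 ∧ (Z.served p ∩ H).Nonempty} × Fin s
  enc p d Y x :=
    ∑ k : {k : Fin K // k ∈ Z.served p ∩ x.1.1},
      Y (d k.1) (x.1.1.erase k.1)
        ⟨x.2, by
          rw [Finset.card_erase_of_mem (Finset.mem_inter.mp k.2).2, x.1.2.1]; rfl⟩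

end CodedCaching

namespace CodedCaching

open Finset

/-! ### Weights on sets of users that depend on the cardinality only -/

/-! The lower bound treats each server separately. By MDS coding, the contents of the `ρ` servers of
a user are in bijection with the library, so the content of one server is uniform and independent of
the other `ρ - 1`. Freezing those others at a favourable value leaves a caching problem with a
single server: for most of its contents, the message and the coded subsegments of the segments
cached by `k` determine those of the file requested by `k` (`Encoding.exists_ambiguous_contents`).

Decoding the users of the server one after another shows that the message carries at least all coded
subsegments of `W_{d_k,A}` with `A` avoiding the users up to `k` (`Encoding.sum_card_sub_le`). The
count is of integer exponents of 2, so a small error probability costs nothing. Averaging over the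
cyclic shifts of a demand vector replaces the sizes for single files by the total weight of `A`
(`sum_weight_le_card_bits`).

If the weight depends only on `|A|`, convexity of binomial coefficients together with the cache
constraint shows that putting all weight on `|A| = t` is the worst case (`avoiding_weight_bound`);
the resulting binomials telescope to the optimal rate. For an arbitrary placement, the sum of the
weights over all permutations of the users is symmetric (`sum_perm_map_eq`), which gives the
averaged bound, and permuting users preserves the uniform topology.

The scheme attains the bound because, in the XOR for `H = A ∪ {k}`, user `k` has cached all segments
except that of `A`; it obtains the coded subsegment of `A` from each of its `ρ` servers and inverts
the MDS code (`proposedEncoding_determines`). Reed–Solomon codes supply the code. -/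

/-- The convex function `x ↦ C(x, j + 1)` lies above its supporting lines. -/
theorem choose_supporting_line (x y j : ℕ) :
    (y.choose (j + 1) : ℝ) + ((x : ℝ) - y) * (y.choose j : ℝ) ≤ (x.choose (j + 1) : ℝ) := by
  rcases le_total y x with h | h
  · obtain ⟨m, rfl⟩ := Nat.exists_eq_add_of_le h
    clear h
    induction m with
    | zero => simp
    | succ m ih =>
      have h1 : (y.choose j : ℝ) ≤ ((y + m).choose j : ℝ) := by
        exact_mod_cast Nat.choose_le_choose j (Nat.le_add_right y m)
      rw [← add_assoc, Nat.choose_succ_succ' (y + m) j]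
      push_cast at ih ⊢
      linarith
  · obtain ⟨m, rfl⟩ := Nat.exists_eq_add_of_le h
    clear h
    induction m with
    | zero => simp
    | succ m ih =>
      have h1 : ((x + m).choose j : ℝ) ≤ ((x + m + 1).choose j : ℝ) := by
        exact_mod_cast Nat.choose_le_choose j (Nat.le_succ _)
      have h2 : ((m : ℝ) + 1) * ((x + m).choose j : ℝ) ≤
          ((m : ℝ) + 1) * ((x + m + 1).choose j : ℝ) := by gcongr
      rw [← add_assoc, Nat.choose_succ_succ' (x + m) j]
      push_cast at ih h2 ⊢
      linarith

/-- Both sides count the ordered pairs of disjoint subsets of sizes `i` and `j` in a `K`-set. -/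
theorem choose_mul_choose_sub (K i j : ℕ) :
    K.choose j * (K - j).choose i = K.choose i * (K - i).choose j := by
  by_cases h : i + j ≤ K
  · have h1 := Nat.choose_mul (n := K) (k := i + j) (s := j) (by omega)
    have h2 := Nat.choose_mul (n := K) (k := i + j) (s := i) (by omega)
    rw [Nat.add_sub_cancel] at h1
    rw [Nat.add_sub_cancel_left] at h2
    rw [← h1, ← h2, Nat.choose_symm_add]
  · rcases Nat.lt_or_ge K j with hj | hj
    · rw [Nat.choose_eq_zero_of_lt hj, Nat.choose_eq_zero_of_lt (by omega : K - i < j)]; simp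
    · rw [Nat.choose_eq_zero_of_lt (by omega : K - j < i)]
      rcases Nat.lt_or_ge K i with hi | hi
      · rw [Nat.choose_eq_zero_of_lt hi]; simp
      · rw [Nat.choose_eq_zero_of_lt (by omega : K - i < j)]; simp

theorem sum_disjoint_apply_card {K : ℕ} (a : ℕ → ℝ) (B : Finset (Fin K)) :
    ∑ A : Finset (Fin K) with Disjoint A B, a #A =
      ∑ i ∈ range (K + 1), ((K - #B).choose i : ℝ) * a i := by
  have h1 : (univ.filter fun A : Finset (Fin K) => Disjoint A B) = (Bᶜ).powerset := by
    ext A; rw [Finset.mem_filter, Finset.mem_powerset, Finset.subset_compl_iff_disjoint_right]; simp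
  rw [h1, Finset.sum_powerset_apply_card, Finset.card_compl, Fintype.card_fin]
  simp only [nsmul_eq_mul]
  -- The range is extended to `K + 1` so that it does not depend on `B`; the added binomials vanish.
  refine Finset.sum_subset (Finset.range_subset_range.mpr (by omega)) fun i _ hi => ?_
  rw [Nat.choose_eq_zero_of_lt (by rw [Finset.mem_range] at hi; omega)]
  simp

/-- After multiplication by `C(K, #B)`, double counting turns the right side into an average of `C(K
- i, #B)` over the sizes `i`. This function is convex in `i`, and its supporting line at `i = t` has
slope `-C(K - t, #B - 1) ≤ 0`, so an upper bound on the mean size is exactly what is needed. -/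
theorem disjoint_weight_bound {K t : ℕ} (ht : t ≤ K) (w : Finset (Fin K) → ℝ)
    (hw : ∀ A, 0 ≤ w A) (hsymm : ∀ A B, #A = #B → w A = w B) {V : ℝ} (hV : ∑ A, w A = V)
    (hmem : ∑ A, (#A : ℝ) * w A ≤ t * V) {B : Finset (Fin K)} (hB : B.Nonempty) :
    V * ((K - #B).choose t : ℝ) / (K.choose t : ℝ) ≤ ∑ A with Disjoint A B, w A := by
  obtain ⟨a, rfl⟩ : ∃ a : ℕ → ℝ, w = fun A => a #A :=
    ⟨Function.extend (fun A : Finset (Fin K) => #A) w 0, funext fun A =>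
      (Function.FactorsThrough.extend_apply (f := fun A : Finset (Fin K) => #A) (g := w)
        (fun A B h => hsymm A B h) 0 A).symm⟩
  obtain ⟨j, hj⟩ : ∃ j, #B = j + 1 := ⟨#B - 1, by have := hB.card_pos; omega⟩
  have hBK : #B ≤ K := by simpa using Finset.card_le_univ B
  have ha : ∀ i ∈ range (K + 1), 0 ≤ a i := by
    intro i hi
    obtain ⟨A, -, hA⟩ := Finset.exists_subset_card_eq (s := (univ : Finset (Fin K))) (n := i)
      (by simp at hi ⊢; omega)
    simpa [hA] using hw A
  have hV' : ∑ i ∈ range (K + 1), (K.choose i : ℝ) * a i = V := by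
    simpa using (sum_disjoint_apply_card a (∅ : Finset (Fin K))).symm.trans (by simpa using hV)
  have hmem' : ∑ i ∈ range (K + 1), (K.choose i : ℝ) * (i * a i) ≤ t * V := by
    refine le_of_eq_of_le ?_ hmem
    simpa using (sum_disjoint_apply_card (fun i => (i : ℝ) * a i) (∅ : Finset (Fin K))).symm
  rw [sum_disjoint_apply_card]
  have hKj : (0 : ℝ) < K.choose #B := by exact_mod_cast Nat.choose_pos hBK
  have hKt : (0 : ℝ) < K.choose t := by exact_mod_cast Nat.choose_pos ht
  have key : V * ((K - t).choose #B : ℝ) ≤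
      ∑ i ∈ range (K + 1), (K.choose i : ℝ) * ((K - i).choose #B : ℝ) * a i := by
    have h1 : ∑ i ∈ range (K + 1), (K.choose i : ℝ) * a i *
          (((K - t).choose #B : ℝ) + ((t : ℝ) - i) * ((K - t).choose j : ℝ)) ≤
        ∑ i ∈ range (K + 1), (K.choose i : ℝ) * ((K - i).choose #B : ℝ) * a i := by
      refine Finset.sum_le_sum fun i hi => ?_
      have hi' : i ≤ K := by simp at hi; omega
      have h2 := choose_supporting_line (K - i) (K - t) j
      rw [Nat.cast_sub ht, Nat.cast_sub hi', ← hj] at h2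
      have h3 : 0 ≤ (K.choose i : ℝ) * a i := mul_nonneg (Nat.cast_nonneg _) (ha i hi)
      calc _ = (K.choose i : ℝ) * a i * (((K - t).choose #B : ℝ) +
              ((K : ℝ) - i - (K - t)) * ((K - t).choose j : ℝ)) := by ring
        _ ≤ (K.choose i : ℝ) * a i * ((K - i).choose #B : ℝ) := by gcongr
        _ = _ := by ring
    refine le_trans ?_ h1
    have h4 : ∑ i ∈ range (K + 1), (K.choose i : ℝ) * a i *
          (((K - t).choose #B : ℝ) + ((t : ℝ) - i) * ((K - t).choose j : ℝ)) =
        (((K - t).choose #B : ℝ) + t * ((K - t).choose j : ℝ)) *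
            ∑ i ∈ range (K + 1), (K.choose i : ℝ) * a i -
          ((K - t).choose j : ℝ) * ∑ i ∈ range (K + 1), (K.choose i : ℝ) * (i * a i) := by
      rw [Finset.mul_sum, Finset.mul_sum, ← Finset.sum_sub_distrib]
      exact Finset.sum_congr rfl fun i _ => by ring
    rw [h4, hV']
    have h5 : ((K - t).choose j : ℝ) * ∑ i ∈ range (K + 1), (K.choose i : ℝ) * (i * a i) ≤
        ((K - t).choose j : ℝ) * (t * V) := by gcongr
    linarith
  have hid : ((K.choose #B : ℕ) : ℝ) * ((K - #B).choose t : ℝ) =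
      (K.choose t : ℝ) * ((K - t).choose #B : ℝ) := by
    exact_mod_cast choose_mul_choose_sub K t #B
  have hsum : (K.choose #B : ℝ) * ∑ i ∈ range (K + 1), ((K - #B).choose i : ℝ) * a i =
      ∑ i ∈ range (K + 1), (K.choose i : ℝ) * ((K - i).choose #B : ℝ) * a i := by
    rw [Finset.mul_sum]
    refine Finset.sum_congr rfl fun i _ => ?_
    rw [← mul_assoc]
    congr 1
    exact_mod_cast choose_mul_choose_sub K i #B
  rw [← hsum] at key
  rw [div_le_iff₀ hKt]
  refine le_of_mul_le_mul_left ?_ hKj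
  calc (K.choose #B : ℝ) * (V * ((K - #B).choose t : ℝ))
      = V * ((K.choose #B : ℝ) * ((K - #B).choose t : ℝ)) := by ring
    _ = V * ((K - t).choose #B : ℝ) * K.choose t := by rw [hid]; ring
    _ ≤ _ := by
      have := mul_le_mul_of_nonneg_right key hKt.le
      linarith

/-- The number of elements of `S` up to `k` is the rank of `k`, and ranks run once through `1, …,
#S`. -/
theorem sum_apply_card_filter_le {α M : Type*} [LinearOrder α] [AddCommMonoid M] (S : Finset α)
    (g : ℕ → M) : ∑ k ∈ S, g #{k' ∈ S | k' ≤ k} = ∑ j ∈ range #S, g (j + 1) := by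
  induction S using Finset.induction_on_max with
  | empty => simp
  | insert m S hm ih =>
    have hmS : m ∉ S := fun h => lt_irrefl _ (hm m h)
    have h1 : ∀ k ∈ S, {k' ∈ insert m S | k' ≤ k} = {k' ∈ S | k' ≤ k} := fun k hk => by
      rw [Finset.filter_insert, if_neg (not_le.mpr (hm k hk))]
    have h2 : {k' ∈ insert m S | k' ≤ m} = insert m S :=
      Finset.filter_true_of_mem fun k hk => by
        rcases Finset.mem_insert.mp hk with rfl | hk
        exacts [le_rfl, (hm k hk).le]
    rw [Finset.sum_insert hmS, h2, Finset.sum_congr rfl fun k hk => by rw [h1 k hk], ih,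
      Finset.card_insert_of_notMem hmS, Finset.sum_range_succ, add_comm]

/-- Telescoping by Pascal's rule. -/
theorem sum_range_choose_sub {K q : ℕ} (hq : q ≤ K) (t : ℕ) :
    ∑ j ∈ range q, ((K - (j + 1)).choose t : ℝ) =
      (K.choose (t + 1) : ℝ) - ((K - q).choose (t + 1) : ℝ) := by
  induction q with
  | zero => simp
  | succ q ih =>
    rw [Finset.sum_range_succ, ih (by omega)]
    obtain ⟨m, rfl⟩ := Nat.exists_eq_add_of_le hq
    rw [show q + 1 + m - q = m + 1 by omega, show q + 1 + m - (q + 1) = m by omega,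
      Nat.choose_succ_succ' m t]
    push_cast
    ring

/-- The weight of the sets that avoid initial segments of `S`, for a weight that depends on the
cardinality only. -/
theorem avoiding_weight_bound {K t : ℕ} (ht : t ≤ K) (w : Finset (Fin K) → ℝ)
    (hw : ∀ A, 0 ≤ w A) (hsymm : ∀ A B, #A = #B → w A = w B) {V : ℝ} (hV : ∑ A, w A = V)
    (hmem : ∑ A, (#A : ℝ) * w A ≤ t * V) (S : Finset (Fin K)) :
    V * ((K.choose (t + 1) : ℝ) - ((K - #S).choose (t + 1) : ℝ)) / (K.choose t : ℝ) ≤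
      ∑ k ∈ S, ∑ A with Disjoint A {k' ∈ S | k' ≤ k}, w A := by
  have hS : #S ≤ K := by simpa using Finset.card_le_univ S
  rw [← sum_range_choose_sub hS,
    ← sum_apply_card_filter_le S fun j => ((K - j).choose t : ℝ), Finset.mul_sum,
    Finset.sum_div]
  exact Finset.sum_le_sum fun k hk => disjoint_weight_bound ht w hw hsymm hV hmem
    ⟨k, by simp [hk]⟩

/-! ### The message of one server -/

namespace Placement

variable {K P N F ρ : ℕ} {C : Placement K P N F}

theorem segment_ext {W W' : Library N F} {n : Fin N}
    (h : ∀ A, C.segment W n A = C.segment W' n A) : W n = W' n :=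
  funext fun b => congrFun (h (C.cachedBy n b)) ⟨b, rfl⟩

theorem cache_ext {W W' : Library N F} {k : Fin K}
    (h : ∀ n A, k ∈ A → C.segment W n A = C.segment W' n A) : C.cache k W = C.cache k W' :=
  funext fun i => congrFun (h i.1.1 _ i.2) ⟨i.1.2, rfl⟩

theorem sum_segSize (n : Fin N) : ∑ A, C.segSize n A = F := by
  simp only [segSize]
  rw [← Fintype.card_sigma, Fintype.card_congr (Equiv.sigmaFiberEquiv (C.cachedBy n)),
    Fintype.card_fin]

theorem sum_card_mul_segSize (n : Fin N) :
    ∑ A, #A * C.segSize n A = ∑ b, #(C.cachedBy n b) := by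
  rw [← Finset.sum_fiberwise (s := univ) (g := C.cachedBy n)]
  refine Finset.sum_congr rfl fun A _ => ?_
  rw [Finset.sum_congr rfl (g := fun _ => #A) fun b hb => by rw [(Finset.mem_filter.mp hb).2],
    Finset.sum_const, segSize, Fintype.card_subtype, smul_eq_mul, mul_comm]

theorem sum_cacheSize : ∑ k, C.cacheSize k = ∑ n, ∑ A, #A * C.segSize n A := by
  simp only [sum_card_mul_segSize, cacheSize, CachePos, Fintype.card_subtype]
  simp only [Finset.card_filter]
  rw [Finset.sum_comm, Fintype.sum_prod_type]
  simp

theorem card_content : Nat.card C.Content = ∏ n, ∏ A, 2 ^ Fintype.card (C.Sub n A) := by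
  simp [Content, Nat.card_pi]

theorem IsMDS.storageSize_eq (hC : C.IsMDS ρ) : ρ * C.storageSize = N * F := by
  rw [storageSize, Finset.mul_sum]
  simp only [Finset.mul_sum, (hC _ _).1, sum_segSize]
  simp

theorem IsMDS.segment_eq (hC : C.IsMDS ρ) {S : Finset (Fin P)} (hS : #S = ρ) {W W' : Library N F}
    {n : Fin N} {A : Finset (Fin K)} (h : ∀ p ∈ S, C.storage p W n A = C.storage p W' n A) :
    C.segment W n A = C.segment W' n A :=
  (hC n A).2 S hS (funext fun p => h p.1 p.2)

/-- The contents of `ρ` servers are in bijection with the library. -/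
theorem IsMDS.storage_bijective (hC : C.IsMDS ρ) {S : Finset (Fin P)} (hS : #S = ρ) :
    Function.Bijective fun (W : Library N F) (p : S) => C.storage p.1 W := by
  refine Function.Injective.bijective_of_nat_card_le (fun W W' h => ?_) ?_
  · exact funext fun n => segment_ext fun A => hC.segment_eq hS fun p hp =>
      congrFun (congrFun (congrFun h ⟨p, hp⟩) n) A
  -- Injectivity suffices, since `ρ` servers together store exactly `N * F` bits.
  · have h1 : Nat.card C.Content = 2 ^ C.storageSize := by
      rw [card_content, storageSize]
      simp only [Finset.prod_pow_eq_pow_sum]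
    have h2 : Nat.card (Library N F) = 2 ^ (N * F) := by
      simp [Library, ← pow_mul, mul_comm]
    rw [h2, Nat.card_fun, h1, ← pow_mul, Nat.card_eq_fintype_card, Fintype.card_coe, hS, mul_comm,
      hC.storageSize_eq]

end Placement

/-- Averaging over the sections of `B`. It allows the contents of all but one server of a user to be
frozen without increasing the fraction of errors beyond `ε`. -/
theorem exists_ncard_section_lt {α β : Type*} [Finite α] [Finite β] {B : Set (α × β)} {ε : ℝ}
    (h : (B.ncard : ℝ) < ε * Nat.card (α × β)) :
    ∃ b, ({a | (a, b) ∈ B}.ncard : ℝ) < ε * Nat.card α := by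
  classical
  have := Fintype.ofFinite α
  have := Fintype.ofFinite β
  by_contra! hcon
  refine absurd h (not_lt.mpr ?_)
  have h1 : B.ncard = ∑ b, {a | (a, b) ∈ B}.ncard := by
    simp only [Set.ncard_eq_toFinset_card', Set.toFinset_card, Set.coe_ofPred,
      Fintype.card_subtype, Finset.card_filter]
    rw [Finset.sum_comm, ← Fintype.sum_prod_type', ← Finset.card_filter, ← Fintype.card_subtype]
  rw [h1, Nat.card_prod, Nat.cast_mul, Nat.card_eq_fintype_card (α := β)]
  push_cast
  calc ε * (Nat.card α * (Fintype.card β : ℝ)) = ∑ _b : β, ε * Nat.card α := by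
        simp; ring
    _ ≤ _ := Finset.sum_le_sum fun b _ => hcon b

namespace Encoding

variable {K P N F ρ : ℕ} {C : Placement K P N F} {E : Encoding C}

/-- For most contents of a server, its message and its coded subsegments that a served user knows
determine all coded subsegments of the file that this user requests. -/
theorem exists_ambiguous_contents (hC : C.IsMDS ρ) {Z : Topology K P ρ} (D : E.Decoding Z)
    (d : Fin K → Fin N) {k : Fin K} {ε : ℝ} (hε : E.errorProb D k d < ε) {p : Fin P}
    (hp : p ∈ (Z k).1) :
    ∃ B : Set C.Content, (B.ncard : ℝ) < ε * Nat.card C.Content ∧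
      ∀ y ∉ B, ∀ y' ∉ B, E.enc p d y = E.enc p d y' →
        (∀ n A, k ∈ A → y n A = y' n A) → ∀ A, y (d k) A = y' (d k) A := by
  -- The library as a pair: the content of `p`, and the contents of the other servers of `k`.
  let Φ := (Equiv.ofBijective _ (hC.storage_bijective (Z k).2)).trans
    (Equiv.funSplitAt (⟨p, hp⟩ : (Z k).1) C.Content)
  have hΦ : ∀ y z, C.storage p (Φ.symm (y, z)) = y := fun y z =>
    congrArg Prod.fst (Φ.apply_symm_apply (y, z))
  have hΦ' : ∀ y z (p' : (Z k).1) (hp' : p' ≠ ⟨p, hp⟩),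
      C.storage p'.1 (Φ.symm (y, z)) = z ⟨p', hp'⟩ := fun y z p' hp' =>
    congrFun (congrArg Prod.snd (Φ.apply_symm_apply (y, z))) ⟨p', hp'⟩
  let W₀ : Set (Library N F) := {W | E.estimate D k d W ≠ W (d k)}
  have hW₀ : ((Φ '' W₀).ncard : ℝ) < ε * Nat.card
      (C.Content × ({j : (Z k).1 // j ≠ ⟨p, hp⟩} → C.Content)) := by
    rw [Set.ncard_image_of_injective _ Φ.injective, ← Nat.card_congr Φ]
    rw [errorProb, div_lt_iff₀ (by exact_mod_cast Fintype.card_pos)] at hε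
    rw [Nat.card_eq_fintype_card]
    refine lt_of_eq_of_lt ?_ hε
    rw [Set.ncard_eq_toFinset_card']
    congr 2
    ext W
    simp [W₀]
  obtain ⟨z, hz⟩ := exists_ncard_section_lt hW₀
  refine ⟨_, hz, fun y hy y' hy' henc hcache A => ?_⟩
  have hdec : ∀ y, ¬ (y, z) ∈ Φ '' W₀ →
      E.estimate D k d (Φ.symm (y, z)) = Φ.symm (y, z) (d k) := fun y hy => by
    by_contra hne
    exact hy ⟨Φ.symm (y, z), hne, Φ.apply_symm_apply _⟩
  -- A segment cached by `k` is determined by its `ρ` coded subsegments: that of `p` agrees by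
  -- assumption, the others belong to the frozen `z`.
  have hc : C.cache k (Φ.symm (y, z)) = C.cache k (Φ.symm (y', z)) :=
    Placement.cache_ext fun n A hA => hC.segment_eq (Z k).2 fun p' hp' => by
      by_cases h : (⟨p', hp'⟩ : (Z k).1) = ⟨p, hp⟩
      · obtain rfl : p' = p := congrArg Subtype.val h
        rw [hΦ, hΦ, hcache n A hA]
      · rw [hΦ' _ _ ⟨p', hp'⟩ h, hΦ' _ _ ⟨p', hp'⟩ h]
  have hm : (fun p' : (Z k).1 => E.message p'.1 d (Φ.symm (y, z))) =
      fun p' : (Z k).1 => E.message p'.1 d (Φ.symm (y', z)) := by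
    funext p'
    simp only [message]
    by_cases h : p' = ⟨p, hp⟩
    · subst h
      rw [hΦ, hΦ, henc]
    · rw [hΦ' _ _ p' h, hΦ' _ _ p' h]
  have hW : Φ.symm (y, z) (d k) = Φ.symm (y', z) (d k) := by
    rw [← hdec y hy, ← hdec y' hy', estimate, estimate, hm, hc]
  rw [← hΦ y z, ← hΦ y' z]
  have hseg : C.segment (Φ.symm (y, z)) (d k) A = C.segment (Φ.symm (y', z)) (d k) A :=
    funext fun b => congrFun hW b.1
  exact congrArg (C.code p (d k) A) hseg

/-- The message of server `p` is as long as the coded subsegments of the files requested by its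
users `k` that are not cached at its users up to `k` in the order given by `τ`. -/
theorem sum_card_sub_le (hC : C.IsMDS ρ) {Z : Topology K P ρ} (D : E.Decoding Z)
    {d : Fin K → Fin N} (hd : Function.Injective d)
    (hD : ∀ k, E.errorProb D k d < 1 / (2 * K + 1)) (p : Fin P) (τ : Equiv.Perm (Fin K)) :
    ∑ k ∈ Z.served p, ∑ A with Disjoint A {k' ∈ Z.served p | τ k' ≤ τ k},
      Fintype.card (C.Sub (d k) A) ≤ Fintype.card (E.Bits p) := by
  classical
  set S := Z.served p with hS
  have hB : ∀ k : Fin K, ∃ B : Set C.Content,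
      (B.ncard : ℝ) < 1 / (2 * K + 1) * Nat.card C.Content ∧ (k ∈ S →
      ∀ y ∉ B, ∀ y' ∉ B, E.enc p d y = E.enc p d y' →
        (∀ n A, k ∈ A → y n A = y' n A) → ∀ A, y (d k) A = y' (d k) A) := by
    intro k
    by_cases hk : k ∈ S
    · obtain ⟨B, h1, h2⟩ := exists_ambiguous_contents hC D d (hD k) (p := p)
        (by simpa [hS, Topology.served] using hk)
      exact ⟨B, h1, fun _ => h2⟩
    · refine ⟨∅, ?_, fun h => absurd h hk⟩
      have : (0 : ℝ) < Nat.card C.Content := by exact_mod_cast Nat.card_pos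
      rw [Set.ncard_empty]
      push_cast
      positivity
  choose B hBcard hBdec using hB
  -- The indices of the coded subsegments that the message has to account for; as `d` is injective,
  -- each arises from only one user.
  let I : Finset (Fin N × Finset (Fin K)) :=
    (S.sigma fun k => {A | Disjoint A {k' ∈ S | τ k' ≤ τ k}}).image fun x => (d x.1, x.2)
  have hI : ∀ n A, (n, A) ∈ I ↔ ∃ k ∈ S, d k = n ∧ ∀ k' ∈ S, τ k' ≤ τ k → k' ∉ A := by
    intro n A
    simp only [I, mem_image, mem_sigma, mem_filter, mem_univ, true_and, Sigma.exists,
      Prod.mk.injEq, Finset.disjoint_right]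
    constructor
    · rintro ⟨k, A', ⟨hk, hA⟩, hn, rfl⟩
      exact ⟨k, hk, hn, fun k' hk' hle => hA ⟨hk', hle⟩⟩
    · rintro ⟨k, hk, hn, hA⟩
      exact ⟨k, A, ⟨hk, fun k' h => hA k' h.1 h.2⟩, hn, rfl⟩
  have hsum : ∑ k ∈ S, ∑ A with Disjoint A {k' ∈ S | τ k' ≤ τ k}, Fintype.card (C.Sub (d k) A) =
      ∑ i ∈ I, Fintype.card (C.Sub i.1 i.2) := by
    rw [Finset.sum_image, Finset.sum_sigma]
    rintro ⟨k, A⟩ - ⟨k', A'⟩ - h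
    obtain ⟨h1, rfl⟩ := Prod.mk.inj h
    obtain rfl := hd h1
    rfl
  rw [hsum]
  let good : Set C.Content := (⋃ k, B k)ᶜ
  -- The `K` exceptional sets cover at most a fraction `K / (2K + 1) < 1/2`, which is where the
  -- bound on the error probability comes from.
  have hgood : Nat.card C.Content < 2 * good.ncard := by
    have h1 : ((⋃ k, B k).ncard : ℝ) ≤ K * (1 / (2 * K + 1) * Nat.card C.Content) := by
      calc ((⋃ k, B k).ncard : ℝ) ≤ ∑ k, ((B k).ncard : ℝ) := by
            exact_mod_cast Set.ncard_iUnion_le_of_fintype B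
        _ ≤ ∑ _k : Fin K, 1 / (2 * K + 1) * (Nat.card C.Content : ℝ) :=
            Finset.sum_le_sum fun k _ => (hBcard k).le
        _ = _ := by simp
    have h2 := Set.ncard_add_ncard_compl (⋃ k, B k)
    have h3 : (0 : ℝ) < Nat.card C.Content := by exact_mod_cast Nat.card_pos
    have h4 : (K : ℝ) * (1 / (2 * K + 1) * Nat.card C.Content) < Nat.card C.Content / 2 := by
      rw [show (K : ℝ) * (1 / (2 * K + 1) * Nat.card C.Content) =
        K * Nat.card C.Content / (2 * K + 1) by ring, div_lt_div_iff₀ (by positivity) two_pos]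
      linarith
    have h5 : ((⋃ k, B k).ncard : ℝ) + (good.ncard : ℝ) = Nat.card C.Content := by
      exact_mod_cast h2
    have h6 : (Nat.card C.Content : ℝ) < 2 * good.ncard := by linarith
    exact_mod_cast h6
  -- A good content is to be recovered from the message and the coded subsegments outside `I`.
  let ψ : good → (E.Bits p → ZMod 2) ×
      ((i : {i : Fin N × Finset (Fin K) // i ∉ I}) → C.Sub i.1.1 i.1.2 → ZMod 2) :=
    fun y => (E.enc p d y.1, fun i => y.1 i.1.1 i.1.2)
  have hψ : Function.Injective ψ := by
    rintro ⟨y, hy⟩ ⟨y', hy'⟩ h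
    obtain ⟨henc, hoff⟩ := Prod.mk.inj h
    have hoff' : ∀ n A, (n, A) ∉ I → y n A = y' n A := fun n A hnA =>
      congrFun hoff ⟨(n, A), hnA⟩
    simp only [good, Set.mem_compl_iff, Set.mem_iUnion, not_exists] at hy hy'
    -- Users are decoded in the order of `τ`. If `k ∈ A` and `(d k', A) ∈ I` through `k'`, then `A`
    -- avoids the users up to `k'`, so `k'` precedes `k` and its file is already known.
    have hon : ∀ m : Fin K, ∀ k ∈ S, τ k = m → ∀ A, y (d k) A = y' (d k) A := by
      intro m
      induction m using WellFoundedLT.induction with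
      | ind m ih =>
        rintro k hk rfl
        refine hBdec k hk y (hy k) y' (hy' k) henc fun n A hkA => ?_
        by_cases hnA : (n, A) ∈ I
        · obtain ⟨k', hk', rfl, hA⟩ := (hI n A).mp hnA
          exact ih (τ k') (not_le.mp fun hle => hA k hk hle hkA) k' hk' rfl A
        · exact hoff' n A hnA
    refine Subtype.ext (funext fun n => funext fun A => ?_)
    by_cases hnA : (n, A) ∈ I
    · obtain ⟨k, hk, rfl, -⟩ := (hI n A).mp hnA
      exact hon _ k hk rfl A
    · exact hoff' n A hnA
  have hcard := Nat.card_le_card_of_injective ψ hψ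
  rw [Nat.card_coe_set_eq, Nat.card_prod] at hcard
  have hbits : Nat.card (E.Bits p → ZMod 2) = 2 ^ Fintype.card (E.Bits p) := by simp
  have hrest : Nat.card ((i : {i : Fin N × Finset (Fin K) // i ∉ I}) →
      C.Sub i.1.1 i.1.2 → ZMod 2) = ∏ i ∈ Iᶜ, 2 ^ Fintype.card (C.Sub i.1 i.2) := by
    have h := Finset.prod_subtype (p := fun i => i ∉ I) (F := inferInstance) Iᶜ (by simp)
      fun i => 2 ^ Fintype.card (C.Sub i.1 i.2)
    rw [h, Nat.card_pi]
    simp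
  have htot : Nat.card C.Content = 2 ^ (∑ i ∈ I, Fintype.card (C.Sub i.1 i.2)) *
      ∏ i ∈ Iᶜ, 2 ^ Fintype.card (C.Sub i.1 i.2) := by
    rw [Placement.card_content, ← Finset.prod_pow_eq_pow_sum, Finset.prod_mul_prod_compl,
      Fintype.prod_prod_type]
  rw [hbits, hrest] at hcard
  rw [htot] at hgood
  have hpos : 0 < ∏ i ∈ Iᶜ, 2 ^ Fintype.card (C.Sub i.1 i.2) :=
    Finset.prod_pos fun i _ => by positivity
  -- The factor 2 lost to bad contents is absorbed: a strict inequality of powers of 2 with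
  -- exponents `a < b + 1` gives `a ≤ b`.
  have hlt : 2 ^ (∑ i ∈ I, Fintype.card (C.Sub i.1 i.2)) < 2 ^ (Fintype.card (E.Bits p) + 1) := by
    refine lt_of_mul_lt_mul_right (a := ∏ i ∈ Iᶜ, 2 ^ Fintype.card (C.Sub i.1 i.2)) ?_ hpos.le
    rw [pow_succ]
    calc _ < 2 * good.ncard := hgood
      _ ≤ 2 * (2 ^ Fintype.card (E.Bits p) * ∏ i ∈ Iᶜ, 2 ^ Fintype.card (C.Sub i.1 i.2)) := by
        gcongr
      _ = _ := by ring
  have := (Nat.pow_lt_pow_iff_right (by norm_num : 1 < 2)).mp hlt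
  omega

end Encoding

/-! ### The lower bounds -/

theorem Topology.served_relabel {K P ρ : ℕ} (Z : Topology K P ρ) (τ : Equiv.Perm (Fin K))
    (p : Fin P) : (Z.relabel τ).served p = (Z.served p).map τ.symm.toEmbedding := by
  ext k
  rw [Finset.mem_map_equiv, Topology.served, Topology.served, Finset.mem_filter, Finset.mem_filter]
  simp [Topology.relabel]

namespace Placement

variable {K P N F ρ : ℕ}

/-- The total size over all files of the segments cached exactly by `A`. -/
noncomputable def weight (C : Placement K P N F) (A : Finset (Fin K)) : ℝ :=
  ∑ n, (C.segSize n A : ℝ)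

variable {C : Placement K P N F}

theorem weight_nonneg (A : Finset (Fin K)) : 0 ≤ C.weight A :=
  Finset.sum_nonneg fun _ _ => Nat.cast_nonneg _

theorem sum_weight : ∑ A, C.weight A = N * F := by
  simp only [weight]
  rw [Finset.sum_comm]
  have h : ∀ n, ∑ A, (C.segSize n A : ℝ) = F := fun n => by exact_mod_cast sum_segSize n
  simp [h]

theorem sum_card_mul_weight_le {t : ℕ} {MS MU : ℝ} (hC : C.Admissible ρ MS MU) (hN : N ≠ 0)
    (ht : (t : ℝ) = K * MU / N) : ∑ A, (#A : ℝ) * C.weight A ≤ t * (N * F) := by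
  have h1 : ∑ A, (#A : ℝ) * C.weight A = ∑ k, (C.cacheSize k : ℝ) := by
    have h := congrArg (Nat.cast (R := ℝ)) (sum_cacheSize (C := C))
    push_cast at h
    rw [h, Finset.sum_comm]
    simp only [weight, Finset.mul_sum]
  have hN' : (N : ℝ) ≠ 0 := by exact_mod_cast hN
  rw [h1, ht]
  calc ∑ k, (C.cacheSize k : ℝ) ≤ ∑ _k : Fin K, (F * MU : ℝ) :=
        Finset.sum_le_sum fun k _ => hC.2.2 k
    _ = _ := by
      simp
      field_simp

end Placement

/-- The bound for one demand vector is summed over the `N` cyclic shifts `k ↦ τ k + c`, under which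
every user requests every file once. Ordering the relabelled users by `τ` carries the avoided sets
back to those of `Z` in the usual order, so `τ` survives only inside the weight and can be averaged
over. -/
theorem sum_weight_le_card_bits {K P N F ρ : ℕ} {C : Placement K P N F} (hC : C.IsMDS ρ)
    (hKN : K ≤ N) {Z : Topology K P ρ} {τ : Equiv.Perm (Fin K)} {E : Encoding C}
    (D : E.Decoding (Z.relabel τ)) (hD : ∀ d k, E.errorProb D k d < 1 / (2 * K + 1)) (p : Fin P) :
    ∑ k ∈ Z.served p, ∑ A with Disjoint A {k' ∈ Z.served p | k' ≤ k},
      C.weight (A.map τ.symm.toEmbedding) ≤ N * (ρ * Fintype.card (E.Bits p)) := by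
  rcases Nat.eq_zero_or_pos N with rfl | hN
  · obtain rfl : K = 0 := by omega
    simp [Finset.eq_empty_of_isEmpty]
  have : NeZero N := ⟨hN.ne'⟩
  set S := Z.served p with hS
  have key : ∀ c : Fin N, ∑ k ∈ S, ∑ A with Disjoint A {k' ∈ S | k' ≤ k},
      Fintype.card (C.Sub (Fin.castLE hKN k + c) (A.map τ.symm.toEmbedding)) ≤
        Fintype.card (E.Bits p) := by
    intro c
    have hd : Function.Injective fun k => Fin.castLE hKN (τ k) + c := fun k k' h =>
      τ.injective (Fin.castLE_injective hKN (add_right_cancel h))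
    refine le_of_eq_of_le ?_ (Encoding.sum_card_sub_le hC D hd (hD _) p τ)
    rw [Topology.served_relabel, Finset.sum_map]
    refine Finset.sum_congr rfl fun k _ => ?_
    refine Finset.sum_equiv (Equiv.finsetCongr τ.symm) (fun A => ?_) fun A _ => ?_
    · have h : ({k' ∈ S.map τ.symm.toEmbedding | τ k' ≤ τ (τ.symm.toEmbedding k)} : Finset _) =
          ({k' ∈ S | k' ≤ k} : Finset _).map τ.symm.toEmbedding := by
        ext k'
        simp [Finset.mem_map_equiv]
      rw [Finset.mem_filter, Finset.mem_filter, ← hS, h, Equiv.finsetCongr_apply,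
        Finset.disjoint_map]
      simp
    · rw [Equiv.finsetCongr_apply, Equiv.coe_toEmbedding, Equiv.apply_symm_apply]
  have hshift : ∀ (k : Fin K) (A : Finset (Fin K)),
      (C.weight A : ℝ) = ρ * ∑ c, (Fintype.card (C.Sub (Fin.castLE hKN k + c) A) : ℝ) := by
    intro k A
    have h : ∑ c, (Fintype.card (C.Sub (Fin.castLE hKN k + c) A) : ℝ) =
        ∑ n, (Fintype.card (C.Sub n A) : ℝ) :=
      Equiv.sum_comp (Equiv.addLeft (Fin.castLE hKN k)) fun n => (Fintype.card (C.Sub n A) : ℝ)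
    rw [h, Placement.weight, Finset.mul_sum]
    exact Finset.sum_congr rfl fun n _ => by exact_mod_cast (hC n A).1.symm
  have hsum : ∑ c : Fin N, ∑ k ∈ S, ∑ A with Disjoint A {k' ∈ S | k' ≤ k},
      (Fintype.card (C.Sub (Fin.castLE hKN k + c) (A.map τ.symm.toEmbedding)) : ℝ) ≤
        N * Fintype.card (E.Bits p) := by
    calc _ ≤ ∑ _c : Fin N, (Fintype.card (E.Bits p) : ℝ) :=
          Finset.sum_le_sum fun c _ => by exact_mod_cast key c
      _ = _ := by simp
  calc _ = (ρ : ℝ) * ∑ c : Fin N, ∑ k ∈ S, ∑ A with Disjoint A {k' ∈ S | k' ≤ k},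
        (Fintype.card (C.Sub (Fin.castLE hKN k + c) (A.map τ.symm.toEmbedding)) : ℝ) := by
        rw [Finset.sum_comm, Finset.mul_sum]
        refine Finset.sum_congr rfl fun k _ => ?_
        rw [Finset.sum_comm, Finset.mul_sum]
        exact Finset.sum_congr rfl fun A _ => hshift k _
    _ ≤ ρ * (N * Fintype.card (E.Bits p)) := by gcongr
    _ = _ := by ring

/-! ### Symmetrization over the users and bounds on the rates -/

theorem exists_perm_map_eq {α : Type*} [Fintype α] [DecidableEq α] {A B : Finset α}
    (h : #A = #B) : ∃ σ : Equiv.Perm α, A.map σ.toEmbedding = B := by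
  refine ⟨(Finset.equivOfCardEq h).extendSubtype, ?_⟩
  refine Finset.eq_of_subset_of_card_le (fun b hb => ?_) (by simp [h])
  obtain ⟨a, ha, rfl⟩ := Finset.mem_map.mp hb
  exact (Finset.equivOfCardEq h).extendSubtype_mem a ha

/-- Permutations act transitively on sets of a given size, and translating the summation variable by
a permutation taking `A` to `B` identifies the two sums. Thus any weight becomes symmetric after
summation. -/
theorem sum_perm_map_eq {α M : Type*} [Fintype α] [DecidableEq α] [AddCommMonoid M]
    (w : Finset α → M) {A B : Finset α} (h : #A = #B) :
    ∑ τ : Equiv.Perm α, w (A.map τ.symm.toEmbedding) =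
      ∑ τ : Equiv.Perm α, w (B.map τ.symm.toEmbedding) := by
  obtain ⟨σ, rfl⟩ := exists_perm_map_eq h
  refine Fintype.sum_equiv (Equiv.mulLeft σ) _ _ fun τ => congrArg w ?_
  rw [Finset.map_map]
  congr 1
  ext a
  simp [Equiv.Perm.mul_def]

section

variable {K P N ρ t : ℕ} {MU : ℝ}

theorem le_of_eq_mul_div (hN : N ≠ 0) (hMUN : MU ≤ N) (ht : (t : ℝ) = K * MU / N) :
    t ≤ K := by
  have hN' : (0 : ℝ) < N := by exact_mod_cast Nat.pos_of_ne_zero hN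
  have : (t : ℝ) ≤ K := by
    rw [ht, div_le_iff₀ hN']
    gcongr
  exact_mod_cast this

/-- Clears the normalization `N * ρ * F`. The multiplicity `m` is 1 for a single topology and `K!`
for a sum over permutations. -/
theorem optRate_le_of_weight_le (hN : N ≠ 0) (hρ : ρ ≠ 0) {m F : ℕ} (hm : m ≠ 0) (hF : F ≠ 0)
    {Z : Topology K P ρ} {p : Fin P} {r : ℝ}
    (h : (m * (N * F) : ℝ) * ((K.choose (t + 1) : ℝ) - ((K - #(Z.served p)).choose (t + 1) : ℝ)) /
      (K.choose t : ℝ) ≤ N * (ρ * (F * r))) : m * optRate t Z p ≤ r := by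
  have hN' : (0 : ℝ) < N := by exact_mod_cast Nat.pos_of_ne_zero hN
  have hρ' : (0 : ℝ) < ρ := by exact_mod_cast Nat.pos_of_ne_zero hρ
  have hF' : (0 : ℝ) < F := by exact_mod_cast Nat.pos_of_ne_zero hF
  have hc : (0 : ℝ) < N * (ρ * F) := by positivity
  refine le_of_mul_le_mul_left ?_ hc
  calc _ = (m * (N * F) : ℝ) * ((K.choose (t + 1) : ℝ) -
        ((K - #(Z.served p)).choose (t + 1) : ℝ)) / (K.choose t : ℝ) := by
        rw [optRate]
        field_simp
    _ ≤ _ := h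
    _ = _ := by ring

theorem symmetric_optRate_le (hKN : K ≤ N) (hN : N ≠ 0) (hρ : ρ ≠ 0) (hMUN : MU ≤ N)
    (ht : (t : ℝ) = K * MU / N) {MS : ℝ} (Z : Topology K P ρ) (R : Topology K P ρ → Fin P → ℝ)
    (hR : Achievable N (fun _ C => C.Symmetric) {Z} MS MU R) (p : Fin P) :
    optRate t Z p ≤ R Z p := by
  -- One `ε` and one `F ≥ 1` are enough: the bound on the message has no error term, so no limit is
  -- taken.
  obtain ⟨F, hF, C, hsymm, hC, hdel⟩ := hR (1 / (2 * K + 1)) (by positivity) 1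
  obtain ⟨E, hE, D, hD⟩ := hdel Z rfl
  have h1 := sum_weight_le_card_bits hC.1 hKN (Z := Z) (τ := 1) D hD p
  have h2 := avoiding_weight_bound (le_of_eq_mul_div hN hMUN ht) C.weight
    Placement.weight_nonneg (fun A B h => by
      simp only [Placement.weight]
      exact_mod_cast hsymm A B h) Placement.sum_weight
    (Placement.sum_card_mul_weight_le hC hN ht) (Z.served p)
  have h3 : ∀ A : Finset (Fin K), A.map (1 : Equiv.Perm (Fin K)).symm.toEmbedding = A := fun A => by
    ext; simp [Finset.mem_map_equiv]
  simp only [h3] at h1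
  have h4 : (N : ℝ) * (ρ * Fintype.card (E.Bits p)) ≤ N * (ρ * (F * R Z p)) := by
    gcongr
    exact hE p
  simpa using optRate_le_of_weight_le (m := 1) hN hρ one_ne_zero (by omega : F ≠ 0)
    (by simpa using h2.trans (h1.trans h4))

theorem optRate_le_average (hKN : K ≤ N) (hN : N ≠ 0) (hρ : ρ ≠ 0) (hMUN : MU ≤ N)
    (ht : (t : ℝ) = K * MU / N) {MS : ℝ} (Z : Topology K P ρ) (R : Topology K P ρ → Fin P → ℝ)
    (hR : Achievable N (fun _ _ => True) (Set.range fun τ : Equiv.Perm (Fin K) => Z.relabel τ)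
      MS MU R) (p : Fin P) :
    K.factorial * optRate t Z p ≤ ∑ τ : Equiv.Perm (Fin K), R (Z.relabel τ) p := by
  obtain ⟨F, hF, C, -, hC, hdel⟩ := hR (1 / (2 * K + 1)) (by positivity) 1
  have hτ : ∀ τ : Equiv.Perm (Fin K), ∑ k ∈ Z.served p,
      ∑ A with Disjoint A {k' ∈ Z.served p | k' ≤ k}, C.weight (A.map τ.symm.toEmbedding) ≤
        N * (ρ * (F * R (Z.relabel τ) p)) := by
    intro τ
    obtain ⟨E, hE, D, hD⟩ := hdel _ ⟨τ, rfl⟩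
    refine (sum_weight_le_card_bits hC.1 hKN D hD p).trans ?_
    gcongr
    exact hE p
  have hcomp : ∀ (τ : Equiv.Perm (Fin K)) (f : Finset (Fin K) → ℝ),
      ∑ A : Finset (Fin K), f (A.map τ.symm.toEmbedding) = ∑ A, f A := fun τ f =>
    (Equiv.finsetCongr τ.symm).sum_comp f
  have hfact : ∀ x : ℝ, ∑ _τ : Equiv.Perm (Fin K), x = K.factorial * x := fun x => by
    simp [Fintype.card_perm]
  -- The same placement serves all relabelled topologies, so its permuted weights may be added; the
  -- sum is symmetric and has total `K! * (N * F)`.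
  have h2 := avoiding_weight_bound (le_of_eq_mul_div hN hMUN ht)
    (fun A : Finset (Fin K) => ∑ τ : Equiv.Perm (Fin K), C.weight (A.map τ.symm.toEmbedding))
    (fun A => Finset.sum_nonneg fun _ _ => Placement.weight_nonneg _)
    (fun A B h => sum_perm_map_eq C.weight h) (V := K.factorial * (N * F))
    (by
      rw [Finset.sum_comm, ← hfact]
      exact Finset.sum_congr rfl fun τ _ => (hcomp τ _).trans Placement.sum_weight)
    (by
      simp only [Finset.mul_sum]
      rw [Finset.sum_comm, mul_left_comm, ← hfact]
      refine Finset.sum_le_sum fun τ _ => ?_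
      refine le_of_eq_of_le ?_ (Placement.sum_card_mul_weight_le hC hN ht)
      refine Eq.trans ?_ (hcomp τ fun A => (#A : ℝ) * C.weight A)
      simp only [Finset.card_map]) (Z.served p)
  refine optRate_le_of_weight_le hN hρ (Nat.factorial_ne_zero K) (by omega : F ≠ 0) (h2.trans ?_)
  calc _ = ∑ τ : Equiv.Perm (Fin K), ∑ k ∈ Z.served p,
        ∑ A with Disjoint A {k' ∈ Z.served p | k' ≤ k}, C.weight (A.map τ.symm.toEmbedding) := by
        rw [Finset.sum_comm]
        exact Finset.sum_congr rfl fun k _ => Finset.sum_comm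
    _ ≤ ∑ τ : Equiv.Perm (Fin K), N * (ρ * (F * R (Z.relabel τ) p)) :=
        Finset.sum_le_sum fun τ _ => hτ τ
    _ = _ := by simp only [Finset.mul_sum]

theorem sum_optRate_le_average_latency (hKN : K ≤ N) (hN : N ≠ 0) (hρ : ρ ≠ 0) (hMUN : MU ≤ N)
    (ht : (t : ℝ) = K * MU / N) {MS : ℝ} (Z : Topology K P ρ) (R : Topology K P ρ → Fin P → ℝ)
    (hR : Achievable N (fun _ _ => True) (Set.range fun τ : Equiv.Perm (Fin K) => Z.relabel τ)
      MS MU R) :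
    ∑ p, optRate t Z p ≤
      (∑ τ : Equiv.Perm (Fin K), latency R (Z.relabel τ)) / (K.factorial : ℝ) := by
  have hfact : (0 : ℝ) < K.factorial := by exact_mod_cast K.factorial_pos
  simp only [latency]
  rw [le_div_iff₀' hfact, Finset.sum_comm, Finset.mul_sum]
  exact Finset.sum_le_sum fun p _ => optRate_le_average hKN hN hρ hMUN ht Z R hR p

theorem expect_average_relabel (f : Topology K P ρ → ℝ) :
    expect (fun Z => (∑ τ : Equiv.Perm (Fin K), f (Z.relabel τ)) / (K.factorial : ℝ)) =
      expect f := by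
  have hfact : (K.factorial : ℝ) ≠ 0 := by exact_mod_cast K.factorial_ne_zero
  have h : ∀ τ : Equiv.Perm (Fin K),
      ∑ Z : Topology K P ρ, f (Z.relabel τ) = ∑ Z : Topology K P ρ, f Z := fun τ =>
    (Equiv.arrowCongr τ.symm (Equiv.refl _)).sum_comp f
  simp only [expect]
  rw [← Finset.sum_div, Finset.sum_comm, Finset.sum_congr rfl fun τ _ => h τ]
  simp [Fintype.card_perm, hfact]

theorem expect_mono {f g : Topology K P ρ → ℝ} (h : ∀ Z, f Z ≤ g Z) : expect f ≤ expect g :=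
  div_le_div_of_nonneg_right (Finset.sum_le_sum fun Z _ => h Z) (Nat.cast_nonneg _)

theorem Achievable.mono {Cl : ∀ F : ℕ, Placement K P N F → Prop} {T T' : Set (Topology K P ρ)}
    {MS : ℝ} {R : Topology K P ρ → Fin P → ℝ} (h : Achievable N Cl T MS MU R) (hT : T' ⊆ T) :
    Achievable N Cl T' MS MU R := fun ε hε F₀ =>
  let ⟨F, hF, C, hCl, hC, hdel⟩ := h ε hε F₀
  ⟨F, hF, C, hCl, hC, fun Z hZ => hdel Z (hT hZ)⟩

end

/-! ### The proposed scheme -/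

section

variable {K P N ρ s t F : ℕ} {e : Fin F ≃ TSet K t × Fin ρ × Fin s}
  {G : Fin P → Fin ρ → Matrix (Fin s) (Fin s) (ZMod 2)}

theorem card_eq_of_equiv (e : Fin F ≃ TSet K t × Fin ρ × Fin s) :
    F = K.choose t * (ρ * s) := by
  simpa using Fintype.card_congr e

theorem proposedPlacement_segSize (n : Fin N) (A : Finset (Fin K)) :
    (proposedPlacement N e G).segSize n A = if #A = t then ρ * s else 0 := by
  have h1 : (proposedPlacement N e G).segSize n A =
      Fintype.card {x : TSet K t × Fin ρ × Fin s // x.1.1 = A} :=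
    Fintype.card_congr (e.subtypeEquiv fun b => Iff.rfl)
  rw [h1]
  split_ifs with hA
  · rw [Fintype.card_congr (β := Fin ρ × Fin s) ?_]
    · simp
    · exact
        { toFun := fun x => x.1.2
          invFun := fun x => ⟨(⟨A, hA⟩, x), rfl⟩
          left_inv := by rintro ⟨⟨⟨A, _⟩, x⟩, rfl⟩; rfl
          right_inv := fun x => rfl }
  · rw [Fintype.card_eq_zero_iff]
    exact ⟨fun x => hA (x.2 ▸ x.1.1.2)⟩

theorem proposedPlacement_symmetric : (proposedPlacement N e G).Symmetric := fun A B h => by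
  simp only [proposedPlacement_segSize, h]

theorem proposedPlacement_isMDS (hG : IsMDSGenerator G) : (proposedPlacement N e G).IsMDS ρ := by
  refine fun n A => ⟨?_, fun S hS w w' h => ?_⟩
  · have h1 : Fintype.card ((proposedPlacement N e G).Sub n A) =
        Nat.card {_i : Fin s // #A = t} := Fintype.card_eq_nat_card
    rw [proposedPlacement_segSize, h1]
    split_ifs with hA <;> simp [hA]
  · funext ⟨b, hb⟩
    have hb' : (e b).1.1 = A := hb
    have hA : #A = t := hb' ▸ (e b).1.2
    have hmem : ∀ l j, (proposedPlacement N e G).cachedBy n (e.symm (⟨A, hA⟩, l, j)) = A :=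
      fun l j => by simp [proposedPlacement]
    have h1 := @hG S hS (fun l j => w ⟨_, hmem l j⟩) (fun l j => w' ⟨_, hmem l j⟩) (by
      funext p i
      have h2 := congrFun (congrFun h p) (⟨i, hA⟩ : {_i : Fin s // #A = t})
      simpa [proposedPlacement] using h2)
    have h3 : e.symm (⟨A, hA⟩, (e b).2.1, (e b).2.2) = b := by
      rw [Equiv.symm_apply_eq]
      exact Prod.ext (Subtype.ext hb'.symm) rfl
    have h4 := congrFun (congrFun h1 (e b).2.1) (e b).2.2
    simpa only [h3] using h4

/-- Counted through the `t`-sets that avoid `k`, which needs no index `t - 1`. -/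
theorem card_tset_mem (k : Fin K) : K * #{A : TSet K t | k ∈ A.1} = t * K.choose t := by
  obtain ⟨m, rfl⟩ : ∃ m, K = m + 1 := ⟨K - 1, by have := k.2; omega⟩
  have h1 : #{A : TSet (m + 1) t | k ∉ A.1} = m.choose t := by
    have h : (({A : TSet (m + 1) t | k ∉ A.1} : Finset _).map (Function.Embedding.subtype _)) =
        powersetCard t (univ.erase k) := by
      ext A
      simp only [mem_map, mem_filter, mem_univ, true_and, Function.Embedding.subtype_apply,
        mem_powersetCard, Subtype.exists, exists_and_right, exists_eq_right, Finset.subset_erase,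
        subset_univ]
      tauto
    rw [← Finset.card_map, h, card_powersetCard]
    simp
  have h2 : #{A : TSet (m + 1) t | k ∈ A.1} + #{A : TSet (m + 1) t | k ∉ A.1} =
      (m + 1).choose t := by
    rw [Finset.card_filter_add_card_filter_not]
    simp
  have h3 := Nat.choose_mul_succ_eq m t
  rcases Nat.lt_or_ge (m + 1) t with ht | ht
  · rw [Nat.choose_eq_zero_of_lt ht] at h2 ⊢
    simp only [Nat.add_eq_zero_iff] at h2
    simp [h2.1]
  · rw [h1] at h2
    zify [ht] at h2 h3 ⊢
    linear_combination ((m : ℤ) + 1) * h2 - h3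

theorem proposedPlacement_cacheSize (k : Fin K) :
    K * (proposedPlacement N e G).cacheSize k = t * (N * F) := by
  have h1 : (proposedPlacement N e G).cacheSize k =
      N * (#{A : TSet K t | k ∈ A.1} * (ρ * s)) := by
    have h2 : (proposedPlacement N e G).cacheSize k =
        Fintype.card (Fin N × {A : TSet K t // k ∈ A.1} × Fin ρ × Fin s) :=
      Fintype.card_congr
        { toFun := fun i => (i.1.1, ⟨(e i.1.2).1, i.2⟩, (e i.1.2).2)
          invFun := fun x => ⟨(x.1, e.symm (x.2.1.1, x.2.2)), by
            simpa [proposedPlacement] using x.2.1.2⟩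
          left_inv := fun i => by simp
          right_inv := fun x => by simp }
    rw [h2]
    simp [Fintype.card_subtype]
  calc _ = N * (ρ * s) * (K * #{A : TSet K t | k ∈ A.1}) := by rw [h1]; ring
    _ = t * (N * (K.choose t * (ρ * s))) := by rw [card_tset_mem]; ring
    _ = _ := by rw [← card_eq_of_equiv e]

theorem proposedPlacement_admissible (hG : IsMDSGenerator G) (hN : N ≠ 0) (hρ : ρ ≠ 0) {MU : ℝ}
    (ht : (t : ℝ) = K * MU / N) : (proposedPlacement N e G).Admissible ρ ((N : ℝ) / ρ) MU := by
  have hN' : (0 : ℝ) < N := by exact_mod_cast Nat.pos_of_ne_zero hN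
  have hρ' : (0 : ℝ) < ρ := by exact_mod_cast Nat.pos_of_ne_zero hρ
  refine ⟨proposedPlacement_isMDS hG, ?_, fun k => ?_⟩
  · have h : (ρ : ℝ) * (proposedPlacement N e G).storageSize = N * F := by
      exact_mod_cast (proposedPlacement_isMDS (N := N) (e := e) hG).storageSize_eq
    rw [← mul_div_assoc, le_div_iff₀ hρ']
    linarith
  · have hK : (0 : ℝ) < K := by exact_mod_cast k.pos
    have h : (K : ℝ) * (proposedPlacement N e G).cacheSize k = t * (N * F) := by
      exact_mod_cast proposedPlacement_cacheSize k
    rw [ht] at h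
    refine le_of_mul_le_mul_left (h.trans ?_).le hK
    field_simp

theorem proposedEncoding_card_bits (hρ : ρ ≠ 0) (ht : t ≤ K) (Z : Topology K P ρ) (p : Fin P) :
    (Fintype.card ((proposedEncoding (N := N) e G Z).Bits p) : ℝ) = F * optRate t Z p := by
  have h1 : Fintype.card ((proposedEncoding (N := N) e G Z).Bits p) =
      #{H : Finset (Fin K) | #H = t + 1 ∧ (Z.served p ∩ H).Nonempty} * s := by
    have h2 : Fintype.card ((proposedEncoding (N := N) e G Z).Bits p) = Nat.card
        ({H : Finset (Fin K) // #H = t + 1 ∧ (Z.served p ∩ H).Nonempty} × Fin s) :=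
      Fintype.card_eq_nat_card
    rw [h2, Nat.card_prod, Nat.card_eq_fintype_card, Fintype.card_subtype, Nat.card_fin]
  -- The `(t + 1)`-sets that miss the served users are those inside the complement.
  have h3 : #{H : Finset (Fin K) | #H = t + 1 ∧ (Z.served p ∩ H).Nonempty} +
      (K - #(Z.served p)).choose (t + 1) = K.choose (t + 1) := by
    have h4 := Finset.card_filter_add_card_filter_not (s := powersetCard (t + 1) univ)
      fun H : Finset (Fin K) => (Z.served p ∩ H).Nonempty
    have h5 : (powersetCard (t + 1) univ).filter
        (fun H : Finset (Fin K) => ¬ (Z.served p ∩ H).Nonempty) =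
          powersetCard (t + 1) (Z.served p)ᶜ := by
      ext H
      rw [mem_filter, mem_powersetCard, mem_powersetCard, Finset.not_nonempty_iff_eq_empty,
        ← Finset.disjoint_iff_inter_eq_empty, Finset.subset_compl_iff_disjoint_left]
      simp [and_comm]
    have h6 : (powersetCard (t + 1) univ).filter
        (fun H : Finset (Fin K) => (Z.served p ∩ H).Nonempty) =
          ({H : Finset (Fin K) | #H = t + 1 ∧ (Z.served p ∩ H).Nonempty} : Finset _) := by
      ext H
      simp [mem_powersetCard]
    rw [h5, h6, card_powersetCard, card_powersetCard, card_compl, card_univ,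
      Fintype.card_fin] at h4
    exact h4
  have h7 : (#{H : Finset (Fin K) | #H = t + 1 ∧ (Z.served p ∩ H).Nonempty} : ℝ) =
      (K.choose (t + 1) : ℝ) - ((K - #(Z.served p)).choose (t + 1) : ℝ) := by
    rw [← h3]
    push_cast
    ring
  have hρ' : (ρ : ℝ) ≠ 0 := by exact_mod_cast hρ
  have hc : (K.choose t : ℝ) ≠ 0 := by exact_mod_cast (Nat.choose_pos ht).ne'
  rw [h1, optRate, card_eq_of_equiv e]
  push_cast
  rw [h7]
  field_simp

/-- The messages of the servers of user `k` and its cache determine the requested file. -/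
theorem proposedEncoding_determines (hG : IsMDSGenerator G) (Z : Topology K P ρ) (k : Fin K)
    (d : Fin K → Fin N) {W W' : Library N F}
    (hm : ∀ p ∈ (Z k).1, (proposedEncoding e G Z).message p d W =
      (proposedEncoding e G Z).message p d W')
    (hc : (proposedPlacement N e G).cache k W = (proposedPlacement N e G).cache k W') :
    W (d k) = W' (d k) := by
  have hcached : ∀ n A, k ∈ A → (proposedPlacement N e G).segment W n A =
      (proposedPlacement N e G).segment W' n A := fun n A hA =>
    funext fun b => congrFun hc ⟨(n, b.1), by rw [b.2]; exact hA⟩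
  refine (proposedPlacement N e G).segment_ext fun A => ?_
  by_cases hkA : k ∈ A
  · exact hcached _ _ hkA
  refine (proposedPlacement_isMDS hG).segment_eq (Z k).2 fun p hp => ?_
  have hp' : k ∈ Z.served p := by simpa [Topology.served] using hp
  refine funext fun i => ?_
  obtain ⟨i, hA⟩ : {_i : Fin s // #A = t} := i
  -- The type of a coded subsegment depends on its set, and the message mentions `(insert k A).erase
  -- k` in place of `A`; this transports between the two.
  have hcongr : ∀ B : Finset (Fin K), B = A → (∀ hB : #B = t,
      (proposedPlacement N e G).storage p W (d k) B (⟨i, hB⟩ : {_i : Fin s // #B = t}) =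
        (proposedPlacement N e G).storage p W' (d k) B (⟨i, hB⟩ : {_i : Fin s // #B = t})) →
      (proposedPlacement N e G).storage p W (d k) A (⟨i, hA⟩ : {_i : Fin s // #A = t}) =
        (proposedPlacement N e G).storage p W' (d k) A (⟨i, hA⟩ : {_i : Fin s // #A = t}) := by
    rintro _ rfl h
    exact h hA
  refine hcongr ((insert k A).erase k) (Finset.erase_insert hkA) fun hB => ?_
  have hk : k ∈ Z.served p ∩ insert k A := by simp [hp']
  have hH : #(insert k A) = t + 1 ∧ (Z.served p ∩ insert k A).Nonempty :=
    ⟨by rw [Finset.card_insert_of_notMem hkA, hA], ⟨k, hk⟩⟩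
  have h := congrFun (hm p hp) ((⟨insert k A, hH⟩, i) :
    {H : Finset (Fin K) // #H = t + 1 ∧ (Z.served p ∩ H).Nonempty} × Fin s)
  simp only [Encoding.message, proposedEncoding] at h
  -- The term of `k` is split off from the XOR. Every other term belongs to a segment of `H \ {k'}`
  -- with `k' ≠ k`, which contains `k` and is therefore cached.
  rw [Fintype.sum_eq_add_sum_compl ⟨k, hk⟩, Fintype.sum_eq_add_sum_compl ⟨k, hk⟩] at h
  rw [Finset.sum_congr rfl fun k' hk' => ?_] at h
  · exact add_right_cancel h
  · have hne : k ≠ k'.1 := fun heq => by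
      rw [mem_compl, mem_singleton] at hk'
      exact hk' (Subtype.ext heq.symm)
    have hseg := hcached (d k'.1) ((insert k A).erase k'.1) (by simp [hne])
    simp only [Placement.storage, hseg]

theorem proposedEncoding_exists_decoding (hG : IsMDSGenerator G) (Z : Topology K P ρ) :
    ∃ D : (proposedEncoding (N := N) e G Z).Decoding Z,
      ∀ k d W, (proposedEncoding (N := N) e G Z).estimate D k d W = W (d k) := by
  classical
  -- The decoder picks any library consistent with what the user sees; all of them agree on the
  -- requested file.
  refine ⟨fun k d m c => if h : ∃ W : Library N F,
    (fun p : (Z k).1 => (proposedEncoding e G Z).message p.1 d W) = m ∧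
      (proposedPlacement N e G).cache k W = c then h.choose (d k) else 0, fun k d W => ?_⟩
  have h : ∃ W' : Library N F, (fun p : (Z k).1 => (proposedEncoding e G Z).message p.1 d W') =
      (fun p : (Z k).1 => (proposedEncoding e G Z).message p.1 d W) ∧
      (proposedPlacement N e G).cache k W' = (proposedPlacement N e G).cache k W :=
    ⟨W, rfl, rfl⟩
  rw [Encoding.estimate, dif_pos h]
  exact proposedEncoding_determines hG Z k d
    (fun p hp => congrFun h.choose_spec.1 ⟨p, hp⟩) h.choose_spec.2

end

/-! ### Existence of the codes and achievability -/

/-- Reed–Solomon codes over the field with `2 ^ s` elements. -/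
theorem exists_isMDSGenerator {P ρ s : ℕ} (hs : P ≤ 2 ^ s) :
    ∃ G : Fin P → Fin ρ → Matrix (Fin s) (Fin s) (ZMod 2), IsMDSGenerator G := by
  rcases Nat.eq_zero_or_pos s with rfl | hs0
  -- Blocks of zero bits are trivial; the degree and cardinality of `GaloisField 2 s` used below
  -- require `s ≠ 0`.
  · exact ⟨0, fun S _ => Function.injective_of_subsingleton _⟩
  have : Fact (Nat.Prime 2) := ⟨Nat.prime_two⟩
  let L := GaloisField 2 s
  have : Fintype L := Fintype.ofFinite L
  let b : Module.Basis (Fin s) (ZMod 2) L :=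
    Module.finBasisOfFinrankEq _ _ (GaloisField.finrank 2 hs0.ne')
  obtain ⟨α⟩ : Nonempty (Fin P ↪ L) := Function.Embedding.nonempty_of_card_le (by
    rw [Fintype.card_fin, ← Nat.card_eq_fintype_card, GaloisField.card 2 s hs0.ne']
    exact hs)
  -- A block of `s` bits is a field element in the basis `b`. Server `p` evaluates the polynomial
  -- with the `ρ` blocks as coefficients at its own point `α p`, multiplication by a power of `α p`
  -- being a binary matrix.
  refine ⟨fun p l => Algebra.leftMulMatrix b (α p ^ (l : ℕ)), fun S hS w w' h => ?_⟩
  have hrepr : ∀ (w : Fin ρ → Fin s → ZMod 2) (p : Fin P),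
      ∑ l : Fin ρ, (Algebra.leftMulMatrix b (α p ^ (l : ℕ))).mulVec (w l) =
        b.equivFun (∑ l : Fin ρ, α p ^ (l : ℕ) * b.equivFun.symm (w l)) := by
    intro w p
    rw [map_sum]
    refine Finset.sum_congr rfl fun l _ => ?_
    have h1 := Algebra.leftMulMatrix_mulVec_repr b (α p ^ (l : ℕ)) (b.equivFun.symm (w l))
    rw [← Module.Basis.equivFun_apply, ← Module.Basis.equivFun_apply,
      LinearEquiv.apply_symm_apply] at h1
    exact h1
  have hzero : (fun l => b.equivFun.symm (w l) - b.equivFun.symm (w' l)) = 0 := by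
    -- Vandermonde: a polynomial with `ρ` coefficients that vanishes at `ρ` distinct points is zero.
    refine Matrix.eq_zero_of_forall_index_sum_pow_mul_eq_zero
      (f := fun j => α (S.orderEmbOfFin hS j))
      (α.injective.comp (S.orderEmbOfFin hS).injective) fun j => ?_
    have h1 := congrFun h ⟨S.orderEmbOfFin hS j, S.orderEmbOfFin_mem hS j⟩
    simp only [hrepr] at h1
    have h2 := b.equivFun.injective h1
    simp only [mul_sub, Finset.sum_sub_distrib]
    exact sub_eq_zero.mpr h2
  funext l
  exact b.equivFun.symm.injective (sub_eq_zero.mp (congrFun hzero l))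

theorem optRate_achievable {K P N ρ t : ℕ} {MU : ℝ} (hN : N ≠ 0) (hρ : ρ ≠ 0) (htK : t ≤ K)
    (ht : (t : ℝ) = K * MU / N) :
    Achievable N (fun _ C => C.Symmetric) (Set.univ : Set (Topology K P ρ)) ((N : ℝ) / ρ) MU
      (optRate t) := by
  intro ε hε F₀
  -- The choice `s = max F₀ P` makes both the field large enough for the code and `F = C(K, t) * ρ *
  -- s` at least `F₀`.
  obtain ⟨G, hG⟩ := exists_isMDSGenerator (P := P) (ρ := ρ) (s := max F₀ P)
    ((le_max_right F₀ P).trans Nat.lt_two_pow_self.le)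
  let e := (Fintype.equivFin (TSet K t × Fin ρ × Fin (max F₀ P))).symm
  refine ⟨_, ?_, proposedPlacement N e G, proposedPlacement_symmetric,
    proposedPlacement_admissible hG hN hρ ht, fun Z _ => ⟨proposedEncoding e G Z,
      fun p => (proposedEncoding_card_bits hρ htK Z p).le, ?_⟩⟩
  · rw [card_eq_of_equiv e]
    calc F₀ ≤ max F₀ P := le_max_left _ _
      _ ≤ ρ * max F₀ P := Nat.le_mul_of_pos_left _ (Nat.pos_of_ne_zero hρ)
      _ ≤ _ := Nat.le_mul_of_pos_left _ (Nat.choose_pos htK)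
  · obtain ⟨D, hD⟩ := proposedEncoding_exists_decoding (e := e) (N := N) hG Z
    refine ⟨D, fun d k => ?_⟩
    simpa [Encoding.errorProb, hD] using hε

end CodedCaching

theorem mainTheorem4 (K P N ρ t : ℕ) (MU : ℝ)
    (hK : 1 ≤ K) (hKN : K ≤ N) (hρ : 1 ≤ ρ) (hρP : ρ ≤ P)
    (hMU : 0 ≤ MU) (hMUN : MU ≤ N) (ht : (t : ℝ) = K * MU / N) :
    -- lower bound at every topology, segment sizes depending on the number of caching users
    (∀ (Z : CodedCaching.Topology K P ρ) (R : CodedCaching.Topology K P ρ → Fin P → ℝ),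
      CodedCaching.Achievable N (fun _ C => C.Symmetric) {Z} ((N : ℝ) / ρ) MU R →
        ∑ p, CodedCaching.optRate t Z p ≤ CodedCaching.latency R Z) ∧
    -- lower bound for all uncoded placements, averaged over the permutations of the users
    (∀ (Z : CodedCaching.Topology K P ρ) (R : CodedCaching.Topology K P ρ → Fin P → ℝ),
      CodedCaching.Achievable N (fun _ _ => True)
          (Set.range fun τ : Equiv.Perm (Fin K) => Z.relabel τ) ((N : ℝ) / ρ) MU R →
        ∑ p, CodedCaching.optRate t Z p ≤
          (∑ τ : Equiv.Perm (Fin K), CodedCaching.latency R (Z.relabel τ)) / (K.factorial : ℝ)) ∧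
    -- lower bound for all uncoded placements, in expectation over the topology
    (∀ R : CodedCaching.Topology K P ρ → Fin P → ℝ,
      CodedCaching.Achievable N (fun _ _ => True) Set.univ ((N : ℝ) / ρ) MU R →
        CodedCaching.expect (fun Z : CodedCaching.Topology K P ρ =>
            ∑ p, CodedCaching.optRate t Z p) ≤
          CodedCaching.expect (CodedCaching.latency R)) ∧
    -- the proposed scheme is in the class, makes no error and has exactly these rates
    (∀ (s F : ℕ) (e : Fin F ≃ CodedCaching.TSet K t × Fin ρ × Fin s)
      (G : Fin P → Fin ρ → Matrix (Fin s) (Fin s) (ZMod 2)), CodedCaching.IsMDSGenerator G →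
        (CodedCaching.proposedPlacement N e G).Admissible ρ ((N : ℝ) / ρ) MU ∧
        (CodedCaching.proposedPlacement N e G).Symmetric ∧
        ∀ Z : CodedCaching.Topology K P ρ,
          (∃ D : (CodedCaching.proposedEncoding (N := N) e G Z).Decoding Z,
            ∀ k d W, (CodedCaching.proposedEncoding (N := N) e G Z).estimate D k d W = W (d k)) ∧
          ∀ p, (Fintype.card ((CodedCaching.proposedEncoding (N := N) e G Z).Bits p) : ℝ) =
            F * CodedCaching.optRate t Z p) ∧
    -- the codes that it needs exist
    (∀ s : ℕ, P ≤ 2 ^ s → ∃ G : Fin P → Fin ρ → Matrix (Fin s) (Fin s) (ZMod 2),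
      CodedCaching.IsMDSGenerator G) ∧
    -- so its rates are achievable for all topologies with one placement
    CodedCaching.Achievable N (fun _ C => C.Symmetric)
      (Set.univ : Set (CodedCaching.Topology K P ρ)) ((N : ℝ) / ρ) MU
      (CodedCaching.optRate t) := by
  have hN : N ≠ 0 := by omega
  have hρ0 : ρ ≠ 0 := by omega
  have htK : t ≤ K := CodedCaching.le_of_eq_mul_div hN hMUN ht
  refine ⟨fun Z R hR => ?_, fun Z R hR => ?_, fun R hR => ?_, fun s F e G hG => ?_, fun s hs => ?_,
    ?_⟩
  · exact Finset.sum_le_sum fun p _ =>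
      CodedCaching.symmetric_optRate_le hKN hN hρ0 hMUN ht Z R hR p
  · exact CodedCaching.sum_optRate_le_average_latency hKN hN hρ0 hMUN ht Z R hR
  -- Averaging the latency over the relabellings of each topology leaves its expectation unchanged
  -- and reduces the claim to the previous bound, topology by topology.
  · rw [← CodedCaching.expect_average_relabel (CodedCaching.latency R)]
    exact CodedCaching.expect_mono fun Z =>
      CodedCaching.sum_optRate_le_average_latency hKN hN hρ0 hMUN ht Z R
        (hR.mono (Set.subset_univ _))
  · exact ⟨CodedCaching.proposedPlacement_admissible hG hN hρ0 ht,
      CodedCaching.proposedPlacement_symmetric, fun Z =>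
        ⟨CodedCaching.proposedEncoding_exists_decoding hG Z,
          CodedCaching.proposedEncoding_card_bits hρ0 htK Z⟩⟩
  · exact CodedCaching.exists_isMDSGenerator hs
  · exact CodedCaching.optRate_achievable hN hρ0 htK ht
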